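/- Let $G$ be a finite network, directed or undirected, in which each link $e$ has capacity $C(e)\ge 0$. Requests arrive one after another at times $a_1\le a_2\le\cdots$ (finitely or infinitely many); request $i$ is a job $(s_i,d_i,f_i)$, asking to send a file of size $f_i>0$ from $s_i$ to $d_i\neq s_i$. For a set $L$ of jobs and $T\ge 0$, say that $L$ is \emph{feasible in time $T$} in a network if there is a multicommodity flow respecting the link capacities (on an undirected link the two directions share the capacity) whose flow for each job $(s,d,f)\in L$ goes from $s$ to $d$ and has rate $f/T$; let $\mathrm{maxflow}(L)$ be the minimum such $T$. The on-line algorithm $\mathtt{BatchLim}$ maintains a chronological list of disjoint time slots, initially empty, each with a set of jobs. When a request $l$ arrives at time $t$, it is assigned to the first slot $[u,v]$ of the list with $u\ge t$ for which the jobs already in the slot together with $l$ are feasible in time $v-u$. If there is no such slot, let $t_n$ be the end of the last slot, or $t_n=t$ if there is no slot or all slots have ended by time $t$; the new slot $[t_n,t_{n+1}]$ with $t_{n+1}=t_n+\max(t_n-t,\mathrm{maxflow}(\{l\}))$ is appended to the list, and $l$ is assigned to it. The completion time of a request is the end of the slot to which it is assigned, and its waiting time is its completion time minus its arrival time. An off-line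 schedule for a set of requests sends each request $i$ over the links at (measurable) time-dependent rates which at each time form a multicommodity flow respecting the link capacities, vanish before the arrival $a_i$ and after the completion time $c_i\ge a_i$, and transmit in total $f_i$ from $s_i$ to $d_i$; the waiting time of request $i$ is $c_i-a_i$. The optimal maximum waiting time of a set of requests is the infimum, over all off-line schedules for it, of the maximum (supremum) waiting time ($\infty$ if there is no schedule with bounded waiting times). \textbf{Theorem.} For every $\varepsilon>0$ and every time $t^*$, when $\mathtt{BatchLim}$ is run in the augmented network, in which every link $e$ has capacity $(1+\varepsilon)C(e)$, the maximum waiting time of the requests arriving up to time $t^*$ is at most $4/\varepsilon$ times the optimal maximum waiting time of these requests in the original network $G$. -/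

import Mathlib

open MeasureTheory
open scoped ENNReal

noncomputable section

/-- A finite network with vertex type `V` and link type `E`. A link `e` joins `src e` and `dst e`
and has capacity `cap e`. A one-way link carries data only from `src e` to `dst e`; any other link
carries data in both directions, which share its capacity. A directed graph has only one-way links,
an undirected graph has none. -/
structure Network (V E : Type*) where
  src : E → V
  dst : E → V
  oneWay : E → Prop
  cap : E → ℝ
  cap_nonneg : ∀ e, 0 ≤ cap e

/-- A job `(s, d, f)`. -/
structure Job (V : Type*) where
  source : V
  dest : V
  size : ℝ
  source_ne_dest : source ≠ dest
  size_pos : 0 < size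

/-- A connection request: a job together with its arrival time. -/
structure Request (V : Type*) extends Job V where
  arrival : ℝ

namespace Network

variable {V E : Type*}

/-- The network in which each capacity is multiplied by `1 + ε`. -/
def augment (G : Network V E) (ε : ℝ) (hε : 0 < ε) : Network V E where
  src := G.src
  dst := G.dst
  oneWay := G.oneWay
  cap e := (1 + ε) * G.cap e
  cap_nonneg e := mul_nonneg (by linarith) (G.cap_nonneg e)

/-- The tail of link `e`, traversed forwards (`true`) or backwards (`false`). -/
def tail (G : Network V E) (e : E) (b : Bool) : V := if b then G.src e else G.dst e

/-- The head of link `e`, traversed forwards (`true`) or backwards (`false`). -/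
def head (G : Network V E) (e : E) (b : Bool) : V := if b then G.dst e else G.src e

variable [Fintype E]

open Classical in
/-- Total rate out of `u` minus total rate into `u`, where `x e b` is the rate on link `e` in
direction `b`. -/
def netOut (G : Network V E) (x : E → Bool → ℝ) (u : V) : ℝ :=
  (∑ e, ∑ b, if G.tail e b = u then x e b else 0) -
    ∑ e, ∑ b, if G.head e b = u then x e b else 0

/-- `x` is a flow from `s` to `d` (its value is `G.netOut x s`), capacities not considered. -/
structure IsFlow (G : Network V E) (s d : V) (x : E → Bool → ℝ) : Prop where
  nonneg : ∀ e b, 0 ≤ x e b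
  direction : ∀ e, G.oneWay e → x e false = 0
  conservation : ∀ u, u ≠ s → u ≠ d → G.netOut x u = 0
  value_nonneg : 0 ≤ G.netOut x s

/-- `x i`, for `i ∈ L`, are concurrent flows for the jobs `job i` (a multicommodity flow) that
together respect the link capacities. -/
structure IsMultiflow {ι : Type*} (G : Network V E) (job : ι → Job V) (L : Finset ι)
    (x : ι → E → Bool → ℝ) : Prop where
  flow : ∀ i ∈ L, G.IsFlow (job i).source (job i).dest (x i)
  capacity : ∀ e, ∑ i ∈ L, (x i e true + x i e false) ≤ G.cap e

/-- `multicomm(G, L, T)`: the jobs in `L` can be transmitted concurrently, at constant rates,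
during a time of length `T`. -/
def Multicomm {ι : Type*} (G : Network V E) (job : ι → Job V) (L : Finset ι) (T : ℝ) : Prop :=
  0 ≤ T ∧ ∃ x : ι → E → Bool → ℝ, G.IsMultiflow job L x ∧
    ∀ i ∈ L, G.netOut (x i) (job i).source * T = (job i).size

/-- `maxflow(G, L)`: the minimum `T` for which `multicomm(G, L, T)` is true. -/
def maxflow {ι : Type*} (G : Network V E) (job : ι → Job V) (L : Finset ι) : ℝ :=
  sInf {T : ℝ | G.Multicomm job L T}

end Network

/-- The requests (numbered `0, 1, …`, there being `N ≤ ∞` of them) that arrive up to time `t`. -/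
def arrivedUpTo {V : Type*} (N : ℕ∞) (req : ℕ → Request V) (t : ℝ) : Set ℕ :=
  {i | (i : ℕ∞) < N ∧ (req i).arrival ≤ t}

/-- The maximum (supremum) over the requests in `S` of the time from arrival to completion. -/
def maxWait {V : Type*} (req : ℕ → Request V) (S : Set ℕ) (completion : ℕ → ℝ) : ℝ≥0∞ :=
  ⨆ i ∈ S, ENNReal.ofReal (completion i - (req i).arrival)

/-- An off-line schedule in the network `G` that serves all the requests in `S`: at each time `τ`
request `i` is sent at rate `rate i τ e b` over link `e` in direction `b`. The rates may vary with
time, form a multicommodity flow at each time, vanish before the arrival and after the completion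
of the request, and transmit its whole file in between. -/
structure Schedule {V E : Type*} [Fintype E] (G : Network V E) (req : ℕ → Request V)
    (S : Set ℕ) where
  completion : ℕ → ℝ
  rate : ℕ → ℝ → E → Bool → ℝ
  arrival_le_completion : ∀ i ∈ S, (req i).arrival ≤ completion i
  measurable_rate : ∀ i ∈ S, ∀ e b, Measurable fun τ => rate i τ e b
  multiflow : ∀ L : Finset ℕ, (L : Set ℕ) ⊆ S → ∀ τ,
    G.IsMultiflow (fun i => (req i).toJob) L (fun i => rate i τ)
  rate_eq_zero : ∀ i ∈ S, ∀ τ, τ ∉ Set.Icc (req i).arrival (completion i) →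
    ∀ e b, rate i τ e b = 0
  transmitted : ∀ i ∈ S,
    ∫ τ in (req i).arrival..completion i, G.netOut (rate i τ) (req i).source = (req i).size

/-- The optimal (least possible) maximum waiting time over all off-line schedules in `G` for the
requests in `S`; it is `∞` if they cannot all be served within bounded time. -/
def optMaxWait {V E : Type*} [Fintype E] (G : Network V E) (req : ℕ → Request V)
    (S : Set ℕ) : ℝ≥0∞ :=
  ⨅ σ : Schedule G req S, maxWait req S σ.completion

namespace BatchLim

/-- A slot `[start, finish]` with the (numbers of the) requests assigned to it. -/
structure Slot where
  start : ℝ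
  finish : ℝ
  jobs : Finset ℕ

/-- Assign request `i` to the first slot of the list that satisfies `P`; return the new list and
the end of that slot, or `none` if there is no such slot. -/
def tryAssign (P : Slot → Prop) [DecidablePred P] (i : ℕ) :
    List Slot → Option (List Slot × ℝ)
  | [] => none
  | σ :: rest =>
    if P σ then some ({σ with jobs := insert i σ.jobs} :: rest, σ.finish)
    else (tryAssign P i rest).map fun r => (σ :: r.1, r.2)

/-- The time from which a new slot can be appended at time `t`: the end of the last slot, or `t` if
there is none or all slots have ended. -/
def nextStart (t : ℝ) (slots : List Slot) : ℝ :=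
  match slots.getLast? with
  | none => t
  | some σ => max t σ.finish

variable {V E : Type*} [Fintype E]

/-- Request `i` fits into the slot `σ`: the slot has not begun before the arrival of the request,
and the multicommodity flow problem for its jobs and the new one is feasible. -/
def Fits (G : Network V E) (req : ℕ → Request V) (i : ℕ) (σ : Slot) : Prop :=
  (req i).arrival ≤ σ.start ∧
    G.Multicomm (fun k => (req k).toJob) (insert i σ.jobs) (σ.finish - σ.start)

open Classical in
/-- How request `i` is handled, given the current chronological list of slots: the new list of
slots, and the completion time that is returned (the end of the slot assigned to the request). -/
def step (G : Network V E) (req : ℕ → Request V) (i : ℕ) (slots : List Slot) :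
    List Slot × ℝ :=
  match tryAssign (Fits G req i) i slots with
  | some r => r
  | none =>
    let t := (req i).arrival
    let start := nextStart t slots
    let M := G.maxflow (fun k => (req k).toJob) {i}
    let finish := if M > start - t then start + M else start + (start - t)
    (slots ++ [⟨start, finish, {i}⟩], finish)

/-- The list of slots after the requests `0, …, n - 1` have been handled. -/
def slots (G : Network V E) (req : ℕ → Request V) : ℕ → List Slot
  | 0 => []
  | n + 1 => (step G req n (slots G req n)).1

/-- The completion time that `BatchLim` assigns to request `i`. -/
def completion (G : Network V E) (req : ℕ → Request V) (i : ℕ) : ℝ :=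
  (step G req i (slots G req i)).2

end BatchLim

end

/-!
Suppose an off-line schedule in `G` lets nobody wait longer than `W`. Averaging it over time shows
that the requests arriving within a time interval of length `ℓ` are feasible in time `ℓ + W` in
`G`, hence in time `T` in the augmented network as soon as `ℓ + W ≤ (1 + ε) * T`.

`BatchLim` delays a slot after the request that opened it by at most the length `T` of the slot. If
`W / ε ≤ T` and the slot has not begun when a request arrives, then its jobs and the new one have
arrived within time `T`, and since `T + W ≤ (1 + ε) * T` the new request fits. So a slot that has
not begun and refuses a request is shorter than `W / ε`, and ends less than `2 * W / ε` after the
arrival of that request; a slot that has begun ends within its own length. By induction every slot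
has length at most `2 * W / ε`, and a request waits at most for the delay and the length of its
slot, together at most `4 * W / ε`.
-/

namespace Network

variable {V E : Type*} [Fintype E] {G : Network V E} {s d : V} {x y : E → Bool → ℝ}

theorem isLinearMap_netOut (G : Network V E) (u : V) :
    IsLinearMap ℝ fun x : E → Bool → ℝ => G.netOut x u where
  map_add x y := by
    simp only [netOut, Pi.add_apply, ite_add_zero, Finset.sum_add_distrib]
    ring
  map_smul c x := by
    simp only [netOut, Pi.smul_apply, smul_eq_mul, ← mul_ite_zero, ← Finset.mul_sum, mul_sub]

theorem continuous_netOut (G : Network V E) (u : V) :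
    Continuous fun x : E → Bool → ℝ => G.netOut x u :=
  ((G.isLinearMap_netOut u).mk' _).continuous_of_finiteDimensional

theorem netOut_integral {α : Type*} [MeasurableSpace α] {μ : Measure α} (G : Network V E) (u : V)
    {f : α → E → Bool → ℝ} (hf : Integrable f μ) :
    G.netOut (∫ t, f t ∂μ) u = ∫ t, G.netOut (f t) u ∂μ :=
  (((G.isLinearMap_netOut u).mk' _).toContinuousLinearMap.integral_comp_comm hf).symm

theorem IsFlow.add (hx : G.IsFlow s d x) (hy : G.IsFlow s d y) : G.IsFlow s d (x + y) where
  nonneg e b := add_nonneg (hx.nonneg e b) (hy.nonneg e b)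
  direction e he := by simp [hx.direction e he, hy.direction e he]
  conservation u hs hd := by
    rw [(G.isLinearMap_netOut u).map_add, hx.conservation u hs hd, hy.conservation u hs hd,
      add_zero]
  value_nonneg := by
    rw [(G.isLinearMap_netOut s).map_add]
    exact add_nonneg hx.value_nonneg hy.value_nonneg

theorem IsFlow.smul {c : ℝ} (hc : 0 ≤ c) (hx : G.IsFlow s d x) : G.IsFlow s d (c • x) where
  nonneg e b := mul_nonneg hc (hx.nonneg e b)
  direction e he := by simp [hx.direction e he]
  conservation u hs hd := by
    rw [(G.isLinearMap_netOut u).map_smul, hx.conservation u hs hd, smul_zero]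
  value_nonneg := by
    rw [(G.isLinearMap_netOut s).map_smul]
    exact mul_nonneg hc hx.value_nonneg

theorem convex_setOf_isFlow (G : Network V E) (s d : V) : Convex ℝ {x | G.IsFlow s d x} :=
  fun _ hx _ hy _ _ ha hb _ => (hx.smul ha).add (hy.smul hb)

theorem isClosed_setOf_isFlow (G : Network V E) (s d : V) : IsClosed {x | G.IsFlow s d x} := by
  have isFlow_iff (x : E → Bool → ℝ) : G.IsFlow s d x ↔
      (∀ e b, 0 ≤ x e b) ∧ (∀ e, G.oneWay e → x e false = 0) ∧
        (∀ u, u ≠ s → u ≠ d → G.netOut x u = 0) ∧ 0 ≤ G.netOut x s :=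
    ⟨fun h => ⟨h.1, h.2, h.3, h.4⟩, fun h => ⟨h.1, h.2.1, h.2.2.1, h.2.2.2⟩⟩
  simp only [isFlow_iff, Set.ofPred_and, Set.ofPred_forall]
  refine .inter ?_ (.inter ?_ (.inter ?_ ?_))
  · exact isClosed_iInter fun e => isClosed_iInter fun b =>
      isClosed_le continuous_const (by fun_prop)
  · exact isClosed_iInter fun e => isClosed_iInter fun _ =>
      isClosed_eq (by fun_prop) continuous_const
  · exact isClosed_iInter fun u => isClosed_iInter fun _ => isClosed_iInter fun _ =>
      isClosed_eq (G.continuous_netOut u) continuous_const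
  · exact isClosed_le continuous_const (G.continuous_netOut s)

section Multiflow

variable {ι : Type*} {job : ι → Job V} {L : Finset ι}

theorem IsMultiflow.average {α : Type*} [MeasurableSpace α] {μ : Measure α} [IsFiniteMeasure μ]
    [NeZero μ] {f : ι → α → E → Bool → ℝ} (hf : ∀ᵐ t ∂μ, G.IsMultiflow job L fun i => f i t)
    (hint : ∀ i ∈ L, Integrable (f i) μ) :
    G.IsMultiflow job L fun i => ⨍ t, f i t ∂μ where
  flow i hi := (G.convex_setOf_isFlow _ _).average_mem (G.isClosed_setOf_isFlow _ _)
    (hf.mono fun _ ht => ht.flow i hi) (hint i hi)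
  capacity e := by
    have isLinearMap_load : IsLinearMap ℝ fun x : E → Bool → ℝ => x e true + x e false :=
      ⟨fun x y => add_add_add_comm _ _ _ _, fun c x => (mul_add c _ _).symm⟩
    have average_sum : ⨍ t, ∑ i ∈ L, f i t ∂μ = ∑ i ∈ L, ⨍ t, f i t ∂μ :=
      integral_finsetSum L fun i hi => (hint i hi).to_average
    have average_load : (⨍ t, ∑ i ∈ L, f i t ∂μ) ∈
        {x : E → Bool → ℝ | x e true + x e false ≤ G.cap e} := by
      refine (convex_halfSpace_le isLinearMap_load _).average_mem
        (isClosed_le (by fun_prop) continuous_const) (hf.mono fun t ht => ?_)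
        (integrable_finsetSum L hint)
      simpa only [Set.mem_ofPred_eq, Finset.sum_apply, Finset.sum_add_distrib] using ht.capacity e
    simpa only [average_sum, Set.mem_ofPred_eq, Finset.sum_apply, Finset.sum_add_distrib]
      using average_load

variable {T : ℝ}

theorem Multicomm.pos (h : G.Multicomm job L T) (hL : L.Nonempty) : 0 < T := by
  obtain ⟨hT, x, -, hsize⟩ := h
  obtain ⟨i, hi⟩ := hL
  refine hT.lt_of_ne' fun hT0 => (job i).size_pos.ne ?_
  rw [← hsize i hi, hT0, mul_zero]

theorem Multicomm.maxflow_le (h : G.Multicomm job L T) : G.maxflow job L ≤ T :=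
  csInf_le ⟨0, fun _ hT => hT.1⟩ h

theorem IsFlow.augment {ε : ℝ} (hε : 0 < ε) (hx : G.IsFlow s d x) :
    (G.augment ε hε).IsFlow s d x :=
  ⟨hx.nonneg, hx.direction, hx.conservation, hx.value_nonneg⟩

theorem Multicomm.augment {ε T' : ℝ} (hε : 0 < ε) (h : G.Multicomm job L T)
    (hT' : T ≤ (1 + ε) * T') : (G.augment ε hε).Multicomm job L T' := by
  obtain ⟨hT, x, hx, hsize⟩ := h
  have hT'0 : 0 ≤ T' := nonneg_of_mul_nonneg_right (hT.trans hT') (by positivity)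
  have hT0 : T' = 0 → T = 0 := by
    rintro rfl
    exact hT.antisymm' (by simpa using hT')
  refine ⟨hT'0, fun i => (T / T') • x i, ⟨fun i hi => ?_, fun e => ?_⟩, fun i hi => ?_⟩
  · exact ((hx.flow i hi).smul (div_nonneg hT hT'0)).augment hε
  · calc
      ∑ i ∈ L, (((T / T') • x i) e true + ((T / T') • x i) e false)
          = T / T' * ∑ i ∈ L, (x i e true + x i e false) := by
        simp only [Pi.smul_apply, smul_eq_mul, ← mul_add, Finset.mul_sum]
      _ ≤ (1 + ε) * G.cap e :=
        mul_le_mul_of_nonneg (div_le_of_le_mul₀ hT'0 (by positivity) hT') (hx.capacity e)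
          (div_nonneg hT hT'0) (G.cap_nonneg e)
  · calc
      G.netOut ((T / T') • x i) (job i).source * T'
          = T / T' * T' * G.netOut (x i) (job i).source := by
        rw [(G.isLinearMap_netOut _).map_smul, smul_eq_mul]
        ring
      _ = (job i).size := by rw [div_mul_cancel_of_imp hT0, mul_comm, hsize i hi]

end Multiflow

/-- Every nonempty finite batch of requests of `S` that arrive within a time interval is feasible
in the length of the interval plus `W`. Of an off-line schedule with waiting times at most `W`,
this is all that the analysis of `BatchLim` uses. -/
def ServesBatches (G : Network V E) (req : ℕ → Request V) (S : Set ℕ) (W : ℝ) : Prop :=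
  ∀ ⦃L : Finset ℕ⦄ ⦃a b : ℝ⦄, L.Nonempty → (L : Set ℕ) ⊆ S →
    (∀ i ∈ L, (req i).arrival ∈ Set.Icc a b) →
      G.Multicomm (fun i => (req i).toJob) L (b - a + W)

section ServesBatches

variable {req : ℕ → Request V} {S : Set ℕ} {W : ℝ} {n : ℕ}

theorem ServesBatches.multicomm_singleton (h : G.ServesBatches req S W) (hn : n ∈ S) :
    G.Multicomm (fun i => (req i).toJob) {n} W := by
  simpa using h (L := {n}) (a := (req n).arrival) (b := (req n).arrival)
    (Finset.singleton_nonempty n) (by simpa using hn) (by simp)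

theorem ServesBatches.pos (h : G.ServesBatches req S W) (hn : n ∈ S) : 0 < W :=
  (h.multicomm_singleton hn).pos (Finset.singleton_nonempty n)

end ServesBatches

end Network

namespace Schedule

variable {V E : Type*} [Fintype E] {G : Network V E} {req : ℕ → Request V} {S : Set ℕ} {i : ℕ}

theorem rate_nonneg (σ : Schedule G req S) (hi : i ∈ S) (τ : ℝ) (e : E) (b : Bool) :
    0 ≤ σ.rate i τ e b :=
  ((σ.multiflow {i} (by simpa using hi) τ).flow i (Finset.mem_singleton_self i)).nonneg e b

theorem rate_le_cap (σ : Schedule G req S) (hi : i ∈ S) (τ : ℝ) (e : E) (b : Bool) :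
    σ.rate i τ e b ≤ G.cap e := by
  have hcap := (σ.multiflow {i} (by simpa using hi) τ).capacity e
  rw [Finset.sum_singleton] at hcap
  have htrue := σ.rate_nonneg hi τ e true
  have hfalse := σ.rate_nonneg hi τ e false
  cases b <;> linarith

theorem integrable_rate (σ : Schedule G req S) (hi : i ∈ S) (μ : Measure ℝ) [IsFiniteMeasure μ] :
    Integrable (σ.rate i) μ := by
  refine .of_eval fun e => .of_eval fun b => ?_
  refine .of_bound (σ.measurable_rate i hi e b).aestronglyMeasurable (G.cap e)
    (ae_of_all _ fun τ => ?_)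
  rw [Real.norm_of_nonneg (σ.rate_nonneg hi τ e b)]
  exact σ.rate_le_cap hi τ e b

theorem arrival_lt_completion (σ : Schedule G req S) (hi : i ∈ S) :
    (req i).arrival < σ.completion i := by
  refine (σ.arrival_le_completion i hi).lt_of_ne fun h => (req i).size_pos.ne ?_
  rw [← σ.transmitted i hi, h, intervalIntegral.integral_same]

theorem setIntegral_netOut_rate (σ : Schedule G req S) (hi : i ∈ S) {a c : ℝ}
    (ha : a ≤ (req i).arrival) (hc : σ.completion i ≤ c) :
    ∫ τ in Set.Icc a c, G.netOut (σ.rate i τ) (req i).source = (req i).size := by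
  rw [← σ.transmitted i hi, intervalIntegral.integral_of_le (σ.arrival_le_completion i hi),
    ← integral_Icc_eq_integral_Ioc]
  refine setIntegral_eq_of_subset_of_forall_sdiff_eq_zero measurableSet_Icc
    (Set.Icc_subset_Icc ha hc) fun τ hτ => ?_
  have hrate : σ.rate i τ = 0 := funext₂ (σ.rate_eq_zero i hi τ hτ.2)
  rw [hrate, (G.isLinearMap_netOut _).map_zero]

theorem multicomm (σ : Schedule G req S) {L : Finset ℕ} (hL : (L : Set ℕ) ⊆ S) {a c : ℝ}
    (hac : a < c) (ha : ∀ i ∈ L, a ≤ (req i).arrival) (hc : ∀ i ∈ L, σ.completion i ≤ c) :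
    G.Multicomm (fun i => (req i).toJob) L (c - a) := by
  set μ : Measure ℝ := volume.restrict (Set.Icc a c) with hμ
  have : NeZero μ := ⟨by simp [hμ, hac]⟩
  have hμ_univ : μ.real Set.univ = c - a := by simp [hμ, hac.le]
  have hint : ∀ i ∈ L, Integrable (σ.rate i) μ := fun i hi => σ.integrable_rate (hL hi) μ
  refine ⟨by linarith, fun i => ⨍ τ, σ.rate i τ ∂μ,
    .average (ae_of_all _ (σ.multiflow L hL)) hint, fun i hi => ?_⟩
  calc
    G.netOut (⨍ τ, σ.rate i τ ∂μ) (req i).source * (c - a)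
        = G.netOut (∫ τ, σ.rate i τ ∂μ) (req i).source := by
      rw [← measure_smul_average, (G.isLinearMap_netOut _).map_smul, hμ_univ, smul_eq_mul, mul_comm]
    _ = ∫ τ, G.netOut (σ.rate i τ) (req i).source ∂μ := G.netOut_integral _ (hint i hi)
    _ = (req i).size := σ.setIntegral_netOut_rate (hL hi) (ha i hi) (hc i hi)

theorem servesBatches (σ : Schedule G req S) {W : ℝ}
    (hW : ∀ i ∈ S, σ.completion i - (req i).arrival ≤ W) : G.ServesBatches req S W := by
  intro L a b hne hL harr
  have hc : ∀ i ∈ L, σ.completion i ≤ b + W := fun i hi => by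
    linarith [hW i (hL hi), (harr i hi).2]
  have hab : a < b + W := by
    obtain ⟨i, hi⟩ := hne
    linarith [(harr i hi).1, σ.arrival_lt_completion (hL hi), hc i hi]
  rw [← add_sub_right_comm]
  exact σ.multicomm hL hab (fun i hi => (harr i hi).1) hc

end Schedule

namespace BatchLim

section TryAssign

variable {P : Slot → Prop} [DecidablePred P] {i : ℕ} {l : List Slot}

theorem tryAssign_eq_none_iff : tryAssign P i l = none ↔ ∀ s ∈ l, ¬P s := by
  induction l with
  | nil => simp [tryAssign]
  | cons s l ih => by_cases hs : P s <;> simp [tryAssign, hs, ih]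

theorem exists_of_tryAssign_eq_some {r : List Slot × ℝ} (h : tryAssign P i l = some r) :
    ∃ l₁ s l₂, l = l₁ ++ s :: l₂ ∧ P s ∧
      r = (l₁ ++ {s with jobs := insert i s.jobs} :: l₂, s.finish) := by
  induction l generalizing r with
  | nil => simp [tryAssign] at h
  | cons s l ih =>
    by_cases hs : P s
    · simp only [tryAssign, hs, if_true, Option.some.injEq] at h
      exact ⟨[], s, l, rfl, hs, h.symm⟩
    · simp only [tryAssign, hs, if_false, Option.map_eq_some_iff] at h
      obtain ⟨r, hr, rfl⟩ := h
      obtain ⟨l₁, s', l₂, rfl, hs', rfl⟩ := ih hr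
      exact ⟨s :: l₁, s', l₂, rfl, hs', rfl⟩

end TryAssign

theorem nextStart_le {t c : ℝ} {l : List Slot} (ht : t ≤ c) (hl : ∀ s ∈ l, s.finish ≤ c) :
    nextStart t l ≤ c := by
  unfold nextStart
  split
  · exact ht
  case h_2 s hs => exact max_le ht (hl s (List.mem_of_getLast? hs))

section Step

variable {V E : Type*} [Fintype E]

/-- The slot that `BatchLim` appends to the list `l` for a request `i` that fits into no slot
of `l`. -/
noncomputable def newSlot (G : Network V E) (req : ℕ → Request V) (i : ℕ) (l : List Slot) :
    Slot where
  start := nextStart (req i).arrival l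
  finish := nextStart (req i).arrival l + max (nextStart (req i).arrival l - (req i).arrival)
    (G.maxflow (fun k => (req k).toJob) {i})
  jobs := {i}

theorem step_cases (G : Network V E) (req : ℕ → Request V) (i : ℕ) (l : List Slot) :
    (∃ l₁ s l₂, l = l₁ ++ s :: l₂ ∧ Fits G req i s ∧
        step G req i l = (l₁ ++ {s with jobs := insert i s.jobs} :: l₂, s.finish)) ∨
      (∀ s ∈ l, ¬Fits G req i s) ∧
        step G req i l = (l ++ [newSlot G req i l], (newSlot G req i l).finish) := by
  classical
  unfold step
  split
  case h_1 r hr => exact .inl (exists_of_tryAssign_eq_some hr)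
  case h_2 hnone =>
    refine .inr ⟨tryAssign_eq_none_iff.1 hnone, ?_⟩
    have finish_eq (x M : ℝ) :
        (if M > x then nextStart (req i).arrival l + M else nextStart (req i).arrival l + x) =
          nextStart (req i).arrival l + max x M := by
      rw [max_def_lt, apply_ite (nextStart (req i).arrival l + ·)]
    simp only [finish_eq, newSlot]

theorem exists_mem_slots_finish_eq_completion (G : Network V E) (req : ℕ → Request V) (i : ℕ) :
    ∃ s ∈ slots G req (i + 1), s.finish = completion G req i := by
  rcases step_cases G req i (slots G req i) with ⟨_, s, _, -, -, hstep⟩ | ⟨-, hstep⟩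
  · exact ⟨{s with jobs := insert i s.jobs}, by simp [slots, hstep], by simp [completion, hstep]⟩
  · exact ⟨newSlot G req i (slots G req i), by simp [slots, hstep], by simp [completion, hstep]⟩

end Step

variable {V E : Type*} {req : ℕ → Request V} {B : ℝ} {n j : ℕ} {s : Slot}

/-- The invariant of a slot `s` opened for request `j`, when the requests `0, …, n - 1` have been
handled: it holds requests from `j` on only, it begins after the arrival of `j` by at most its own
length, and this length is at most `B`. -/
structure IsOpenedBy (req : ℕ → Request V) (B : ℝ) (n j : ℕ) (s : Slot) : Prop where
  lt : j < n
  jobs_subset : s.jobs ⊆ Finset.Ico j n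
  delay_le_length : s.start - (req j).arrival ≤ s.finish - s.start
  length_le : s.finish - s.start ≤ B

theorem IsOpenedBy.succ (h : IsOpenedBy req B n j s) : IsOpenedBy req B (n + 1) j s where
  lt := h.lt.trans n.lt_succ_self
  jobs_subset := h.jobs_subset.trans (Finset.Ico_subset_Ico_right n.le_succ)
  delay_le_length := h.delay_le_length
  length_le := h.length_le

theorem IsOpenedBy.assign (h : IsOpenedBy req B n j s) :
    IsOpenedBy req B (n + 1) j {s with jobs := insert n s.jobs} :=
  { h.succ with
    jobs_subset := Finset.insert_subset (Finset.mem_Ico.2 ⟨h.lt.le, n.lt_succ_self⟩)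
      h.succ.jobs_subset }

variable [Fintype E] {G : Network V E} {S : Set ℕ} {ε W : ℝ} {l : List Slot}

theorem IsOpenedBy.length_lt_of_not_fits (h : IsOpenedBy req B n j s)
    (hG : G.ServesBatches req S W) (hS : IsLowerSet S)
    (hreq : MonotoneOn (fun i => (req i).arrival) S) (hn : n ∈ S) (hε : 0 < ε)
    (hstart : (req n).arrival ≤ s.start) (hfit : ¬Fits (G.augment ε hε) req n s) :
    s.finish - s.start < W / ε := by
  by_contra! hlong
  have hjobs : ∀ k ∈ insert n s.jobs, j ≤ k ∧ k ≤ n := fun k hk => by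
    simpa [Nat.lt_succ_iff] using h.assign.jobs_subset hk
  have hmem : ∀ k ≤ n, k ∈ S := fun k hk => hS hk hn
  have harr : ∀ k ∈ insert n s.jobs, (req k).arrival ∈ Set.Icc (req j).arrival (req n).arrival :=
    fun k hk =>
      have ⟨hjk, hkn⟩ := hjobs k hk
      ⟨hreq (hmem j h.lt.le) (hmem k hkn) hjk, hreq (hmem k hkn) hn hkn⟩
  have hbatch := hG (Finset.insert_nonempty n s.jobs) (fun k hk => hmem k (hjobs k hk).2) harr
  refine hfit ⟨hstart, hbatch.augment hε ?_⟩
  calc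
    (req n).arrival - (req j).arrival + W
        ≤ (s.finish - s.start) + ε * (s.finish - s.start) :=
      add_le_add (by linarith [h.delay_le_length]) ((div_le_iff₀' hε).1 hlong)
    _ = (1 + ε) * (s.finish - s.start) := by ring

theorem IsOpenedBy.finish_le_of_not_fits (h : IsOpenedBy req (2 * (W / ε)) n j s)
    (hG : G.ServesBatches req S W) (hS : IsLowerSet S)
    (hreq : MonotoneOn (fun i => (req i).arrival) S) (hn : n ∈ S) (hε : 0 < ε)
    (hfit : ¬Fits (G.augment ε hε) req n s) :
    s.finish ≤ (req n).arrival + 2 * (W / ε) := by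
  rcases le_total s.start (req n).arrival with hbegun | hstart
  · linarith [h.length_le]
  · have hshort := h.length_lt_of_not_fits hG hS hreq hn hε hstart hfit
    linarith [hreq (hS h.lt.le hn) hn h.lt.le, h.delay_le_length]

theorem isOpenedBy_newSlot (hG : G.ServesBatches req S W) (hS : IsLowerSet S)
    (hreq : MonotoneOn (fun i => (req i).arrival) S) (hn : n ∈ S) (hε : 0 < ε)
    (hl : ∀ s ∈ l, ∃ j, IsOpenedBy req (2 * (W / ε)) n j s)
    (hfit : ∀ s ∈ l, ¬Fits (G.augment ε hε) req n s) :
    IsOpenedBy req (2 * (W / ε)) (n + 1) n (newSlot (G.augment ε hε) req n l) := by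
  have hWε : 0 < W / ε := div_pos (hG.pos hn) hε
  have hstart : nextStart (req n).arrival l ≤ (req n).arrival + 2 * (W / ε) :=
    nextStart_le (by linarith) fun s hs =>
      have ⟨_, hj⟩ := hl s hs
      hj.finish_le_of_not_fits hG hS hreq hn hε (hfit s hs)
  have hmaxflow : (G.augment ε hε).maxflow (fun k => (req k).toJob) {n} ≤ W / ε :=
    ((hG.multicomm_singleton hn).augment hε
      (by rw [add_mul, mul_div_cancel₀ _ hε.ne']; linarith)).maxflow_le
  refine ⟨n.lt_succ_self, by simp [newSlot], ?_, ?_⟩ <;>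
    simp only [newSlot, add_sub_cancel_left]
  · exact le_max_left _ _
  · exact max_le (by linarith) (by linarith)

theorem exists_isOpenedBy_of_mem_step (hG : G.ServesBatches req S W) (hS : IsLowerSet S)
    (hreq : MonotoneOn (fun i => (req i).arrival) S) (hn : n ∈ S) (hε : 0 < ε)
    (hl : ∀ s ∈ l, ∃ j, IsOpenedBy req (2 * (W / ε)) n j s) :
    ∀ s ∈ (step (G.augment ε hε) req n l).1, ∃ j, IsOpenedBy req (2 * (W / ε)) (n + 1) j s := by
  have hl_succ : ∀ s ∈ l, ∃ j, IsOpenedBy req (2 * (W / ε)) (n + 1) j s :=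
    fun s hs => (hl s hs).imp fun _ => IsOpenedBy.succ
  rcases step_cases (G.augment ε hε) req n l with ⟨l₁, s₀, l₂, rfl, -, hstep⟩ | ⟨hfit, hstep⟩
  · obtain ⟨j, hj⟩ := hl s₀ (by simp)
    simp only [List.forall_mem_append, List.forall_mem_cons, hstep] at hl_succ ⊢
    exact ⟨hl_succ.1, ⟨j, hj.assign⟩, hl_succ.2.2⟩
  · simp only [List.forall_mem_append, List.forall_mem_singleton, hstep]
    exact ⟨hl_succ, n, isOpenedBy_newSlot hG hS hreq hn hε hl hfit⟩

theorem exists_isOpenedBy_of_mem_slots (hG : G.ServesBatches req S W) (hS : IsLowerSet S)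
    (hreq : MonotoneOn (fun i => (req i).arrival) S) (hn : Set.Iio n ⊆ S) (hε : 0 < ε) :
    ∀ s ∈ slots (G.augment ε hε) req n, ∃ j, IsOpenedBy req (2 * (W / ε)) n j s := by
  induction n with
  | zero => simp [slots]
  | succ n ih =>
    exact exists_isOpenedBy_of_mem_step hG hS hreq (hn n.lt_succ_self) hε
      (ih ((Set.Iio_subset_Iio n.le_succ).trans hn))

theorem completion_sub_arrival_le (hG : G.ServesBatches req S W) (hS : IsLowerSet S)
    (hreq : MonotoneOn (fun i => (req i).arrival) S) (hn : n ∈ S) (hε : 0 < ε) :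
    completion (G.augment ε hε) req n - (req n).arrival ≤ 4 / ε * W := by
  obtain ⟨s, hs, hfinish⟩ := exists_mem_slots_finish_eq_completion (G.augment ε hε) req n
  obtain ⟨j, hj⟩ := exists_isOpenedBy_of_mem_slots hG hS hreq
    (fun k hk => hS (Nat.lt_succ_iff.1 hk) hn) hε s hs
  have hjn : j ≤ n := Nat.lt_succ_iff.1 hj.lt
  calc
    completion (G.augment ε hε) req n - (req n).arrival
        ≤ s.finish - (req j).arrival := by
      rw [hfinish]
      exact sub_le_sub_left (hreq (hS hjn hn) hn hjn) _
    _ = (s.start - (req j).arrival) + (s.finish - s.start) := by ring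
    _ ≤ 2 * (W / ε) + 2 * (W / ε) :=
      add_le_add (hj.delay_le_length.trans hj.length_le) hj.length_le
    _ = 4 / ε * W := by ring

end BatchLim

theorem maxWait_le_ofReal_iff {V : Type*} {req : ℕ → Request V} {S : Set ℕ} {c : ℕ → ℝ} {B : ℝ}
    (hB : 0 ≤ B) :
    maxWait req S c ≤ ENNReal.ofReal B ↔ ∀ i ∈ S, c i - (req i).arrival ≤ B := by
  simp only [maxWait, iSup₂_le_iff, ENNReal.ofReal_le_ofReal_iff hB]

theorem mainTheorem2_general {V E : Type*} [Fintype E] (G : Network V E) (req : ℕ → Request V)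
    {S : Set ℕ} (hS : IsLowerSet S) (hreq : MonotoneOn (fun i => (req i).arrival) S)
    {ε : ℝ} (hε : 0 < ε) :
    maxWait req S (BatchLim.completion (G.augment ε hε) req) ≤
      ENNReal.ofReal (4 / ε) * optMaxWait G req S := by
  have hc : 0 < 4 / ε := by positivity
  rw [optMaxWait, ENNReal.mul_iInf_of_ne (ENNReal.ofReal_pos.2 hc).ne' ENNReal.ofReal_ne_top]
  refine le_iInf fun σ => ?_
  rcases eq_or_ne (maxWait req S σ.completion) ⊤ with htop | hfinite
  · simp [htop, hc]
  set W := (maxWait req S σ.completion).toReal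
  have hW : ENNReal.ofReal W = maxWait req S σ.completion := ENNReal.ofReal_toReal hfinite
  have hW0 : 0 ≤ W := ENNReal.toReal_nonneg
  have hG : G.ServesBatches req S W :=
    σ.servesBatches ((maxWait_le_ofReal_iff hW0).1 hW.ge)
  rw [← hW, ← ENNReal.ofReal_mul hc.le, maxWait_le_ofReal_iff (by positivity)]
  exact fun n hn => BatchLim.completion_sub_arrival_le hG hS hreq hn hε

section ArrivedUpTo

variable {V : Type*} {N : ℕ∞} {req : ℕ → Request V}

theorem isLowerSet_arrivedUpTo
    (hreq : ∀ i j : ℕ, i ≤ j → (j : ℕ∞) < N → (req i).arrival ≤ (req j).arrival) (t : ℝ) :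
    IsLowerSet (arrivedUpTo N req t) :=
  fun j i hij ⟨hjN, hjt⟩ =>
    ⟨(Nat.cast_le.2 hij).trans_lt hjN, (hreq i j hij hjN).trans hjt⟩

theorem monotoneOn_arrival_arrivedUpTo
    (hreq : ∀ i j : ℕ, i ≤ j → (j : ℕ∞) < N → (req i).arrival ≤ (req j).arrival) (t : ℝ) :
    MonotoneOn (fun i => (req i).arrival) (arrivedUpTo N req t) :=
  fun i _ j hj hij => hreq i j hij hj.1

end ArrivedUpTo

theorem mainTheorem2 {V E : Type*} [Fintype V] [Fintype E] (G : Network V E)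
    (N : ℕ∞) (req : ℕ → Request V)
    (hreq : ∀ i j : ℕ, i ≤ j → (j : ℕ∞) < N → (req i).arrival ≤ (req j).arrival)
    (ε : ℝ) (hε : 0 < ε) (tstar : ℝ) :
    maxWait req (arrivedUpTo N req tstar) (BatchLim.completion (G.augment ε hε) req) ≤
      ENNReal.ofReal (4 / ε) * optMaxWait G req (arrivedUpTo N req tstar) :=
  mainTheorem2_general G req (isLowerSet_arrivedUpTo hreq tstar)
    (monotoneOn_arrival_arrivedUpTo hreq tstar) hε
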